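/- Theorem. All graphs are finite and simple. For a graph $G$, let ${}^2G$ be the multigraph obtained from $G$ by doubling each edge, that is, by replacing each edge with two parallel edges. A multigraph is \emph{locally irregular} if any two adjacent vertices have distinct degrees, where parallel edges are counted separately in degrees. A \emph{locally irregular edge coloring} of a multigraph $M$ is a coloring of its edges, in which parallel edges may receive different colors, such that the edges of each color form a locally irregular submultigraph of $M$. If $M$ has such a coloring, then ${\rm lir}(M)$ denotes the smallest number of colors in one. For every connected graph $G$ that is not isomorphic to $K_2$, the multigraph ${}^2G$ has a locally irregular edge coloring, and ${\rm lir}({}^2G)\leq 76$. -/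

import Mathlib

/-- A loopless multigraph on the vertex set `V`, given by the multiplicity of each potential edge;
multiplicity `0` means that the edge is absent. -/
@[ext]
structure Multigraph (V : Type*) where
  /-- The number of parallel edges joining the two members of an unordered pair. -/
  mult : Sym2 V → ℕ
  /-- There are no loops. -/
  mult_eq_zero_of_isDiag : ∀ e : Sym2 V, e.IsDiag → mult e = 0

namespace Multigraph

variable {V : Type*}

/-- Two vertices are adjacent if at least one edge joins them. -/
def Adj (M : Multigraph V) (u v : V) : Prop := 0 < M.mult s(u, v)

/-- The type of single edges of `M`: parallel edges are distinct elements. -/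
abbrev Edge (M : Multigraph V) : Type _ := Σ e : Sym2 V, Fin (M.mult e)

/-- The degree of a vertex: the number of single edges incident to it. -/
def degree [Fintype V] (M : Multigraph V) (v : V) : ℕ := ∑ w : V, M.mult s(v, w)

/-- A multigraph is locally irregular if adjacent vertices have distinct degrees. -/
def IsLocallyIrregular [Fintype V] (M : Multigraph V) : Prop :=
  ∀ u v : V, M.Adj u v → M.degree u ≠ M.degree v

/-- The submultigraph formed by the single edges that have color `a` under the coloring `c`.
Parallel edges may have different colors. -/
def colorClass (M : Multigraph V) {k : ℕ} (c : M.Edge → Fin k) (a : Fin k) : Multigraph V where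
  mult e := Fintype.card {i : Fin (M.mult e) // c ⟨e, i⟩ = a}
  mult_eq_zero_of_isDiag e he := by
    have h := Fintype.card_subtype_le (fun i : Fin (M.mult e) => c ⟨e, i⟩ = a)
    have h' := (Fintype.card_fin (M.mult e)).trans (M.mult_eq_zero_of_isDiag e he)
    exact Nat.le_zero.mp (h.trans h'.le)

/-- An edge coloring is locally irregular if every color induces a locally irregular
submultigraph. -/
def IsLocallyIrregularColoring [Fintype V] (M : Multigraph V) {k : ℕ} (c : M.Edge → Fin k) :
    Prop :=
  ∀ a : Fin k, (M.colorClass c a).IsLocallyIrregular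

/-- `M` has a locally irregular edge coloring with (at most) `k` colors. -/
def LocallyIrregularColorable [Fintype V] (M : Multigraph V) (k : ℕ) : Prop :=
  ∃ c : M.Edge → Fin k, M.IsLocallyIrregularColoring c

/-- The locally irregular chromatic index: the smallest number of colors in a locally irregular
edge coloring of `M`, and `⊤` if `M` has no such coloring. -/
noncomputable def lir [Fintype V] (M : Multigraph V) : ℕ∞ :=
  ⨅ k ∈ {k : ℕ | M.LocallyIrregularColorable k}, (k : ℕ∞)

end Multigraph

open Classical in
/-- The 2-multigraph of a simple graph, obtained by doubling each edge. -/
noncomputable def SimpleGraph.doubled {V : Type*} (G : SimpleGraph V) : Multigraph V where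
  mult e := if e ∈ G.edgeSet then 2 else 0
  mult_eq_zero_of_isDiag _ he := if_neg fun h => G.not_isDiag_of_mem_edgeSet h he

/-! Only the number of copies of an edge that a color takes matters, so the task is to write the
weighting 2 on the edges of `G` as a sum of few locally irregular weightings. Adjacent degrees are
told apart mainly by parity, and parities are prescribed by T-joins, that is, sums of paths modulo
2.

Bipartite graphs (`decomp_bipartite`): if a component has a side of even size, some `J` has odd
degrees exactly on that side, and then both `J` and its complement in the doubled graph distinguish
the sides. If both sides are odd, one vertex whose removal does not disconnect the component is set
aside, at the cost of a third weighting.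

Connected graphs with 32 colors (`decomp_of_coloring`): orient the graph with even out-degrees
except at a root. With a suitable family of fifteen bipartitions of the colors, the out-neighbors of
each vertex can be paired so that one bipartition separates both members from that vertex. This
gives fifteen bipartite graphs without isolated edges, and two short paths repair the root: 15 * 3 +
2 = 47 weightings.

General graphs: in an optimal partition into nine parts, a vertex has at least four times as many
edges to any four other parts as inside its own. These absorb the inner edges with two weightings
per part (`exists_decomp_inside`), 18 in all. The rest is 9-colorable; a spanning tree reserved
beforehand makes it connected and 18-colorable. The total is 18 + 47 = 65. -/

namespace LocallyIrregular

open Finset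
open scoped Classical

variable {V : Type*} [Fintype V]

/-! ### Sums of locally irregular weightings -/

/-- The weighted degree of a vertex in a weighting of the pairs of vertices. -/
def wdeg (w : V → V → ℕ) (v : V) : ℕ := ∑ u, w v u

/-- Vertices joined by positive weight have distinct weighted degrees. -/
def IsLI (w : V → V → ℕ) : Prop := ∀ u v, 0 < w u v → wdeg w u ≠ wdeg w v

/-- The weighting `m` is a sum of `k` symmetric locally irregular weightings. -/
def Decomp (k : ℕ) (m : V → V → ℕ) : Prop :=
  ∃ w : Fin k → V → V → ℕ, (∀ c u v, w c u v = w c v u) ∧ (∀ c, IsLI (w c)) ∧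
    ∀ u v, ∑ c, w c u v = m u v

/-- The weighting that gives weight two to the edges of a graph. -/
noncomputable def dbl (G : SimpleGraph V) (u v : V) : ℕ := if G.Adj u v then 2 else 0

theorem dbl_comm {V : Type*} (G : SimpleGraph V) (u v : V) : dbl G u v = dbl G v u := by
  simp [dbl, G.adj_comm]

theorem Decomp.single {m : V → V → ℕ} (hs : ∀ u v, m u v = m v u) (h : IsLI m) : Decomp 1 m :=
  ⟨fun _ => m, fun _ => hs, fun _ => h, by simp⟩

theorem Decomp.zero : Decomp 0 (fun _ _ : V => 0) :=
  ⟨fun _ _ _ => 0, by simp, fun c => c.elim0, by simp⟩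

theorem Decomp.add {k l : ℕ} {m n : V → V → ℕ} (hm : Decomp k m) (hn : Decomp l n) :
    Decomp (k + l) (fun u v => m u v + n u v) := by
  obtain ⟨w, ws, wl, wm⟩ := hm
  obtain ⟨x, xs, xl, xm⟩ := hn
  refine ⟨Fin.append w x, fun c => ?_, fun c => ?_, fun u v => ?_⟩
  · refine Fin.addCases (fun i => ?_) (fun i => ?_) c
    · simpa using ws i
    · simpa using xs i
  · refine Fin.addCases (fun i => ?_) (fun i => ?_) c
    · simpa using wl i
    · simpa using xl i
  · simp [Fin.sum_univ_add, wm, xm]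

theorem Decomp.congr {k : ℕ} {m n : V → V → ℕ} (h : Decomp k m) (e : ∀ u v, m u v = n u v) :
    Decomp k n := by
  obtain rfl : m = n := funext₂ e
  exact h

theorem Decomp.sum {n k : ℕ} {m : Fin n → V → V → ℕ} (h : ∀ i, Decomp k (m i)) :
    Decomp (n * k) (fun u v => ∑ i, m i u v) := by
  induction n with
  | zero => simpa using Decomp.zero
  | succ n ih =>
    rw [Nat.succ_mul]
    exact ((ih fun i => h i.castSucc).add (h (Fin.last n))).congr
      fun u v => (Fin.sum_univ_castSucc fun i => m i u v).symm

theorem isLI_zero : IsLI (fun _ _ : V => 0) := fun _ _ h => absurd h (by simp)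

theorem Decomp.mono {k l : ℕ} {m : V → V → ℕ} (h : Decomp k m) (hkl : k ≤ l) : Decomp l m := by
  obtain ⟨d, rfl⟩ := Nat.exists_eq_add_of_le hkl
  have h0 : ∀ d, Decomp d (fun _ _ : V => 0) := fun d =>
    ⟨fun _ _ _ => 0, by simp, fun _ => isLI_zero, by simp⟩
  exact (h.add (h0 d)).congr (by simp)

theorem exists_fin_coloring {k n : ℕ} (W : Fin k → ℕ) (h : ∑ a, W a = n) :
    ∃ c : Fin n → Fin k, ∀ a, Fintype.card {i // c i = a} = W a := by
  subst h
  let E : Fin (∑ a, W a) ≃ Σ a, Fin (W a) := finSigmaFinEquiv.symm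
  refine ⟨fun i => (E i).1, fun a => ?_⟩
  have e1 : {i // (E i).1 = a} ≃ {s : Σ a, Fin (W a) // s.1 = a} :=
    E.subtypeEquiv fun _ => Iff.rfl
  rw [Fintype.card_congr (e1.trans (Equiv.sigmaSubtype a)), Fintype.card_fin]

/-- Parallel edges are interchangeable, so any weightings with the right sum can be realized by
coloring the copies of each edge separately. -/
theorem Decomp.colorable {G : SimpleGraph V} {k : ℕ} (h : Decomp k (dbl G)) :
    G.doubled.LocallyIrregularColorable k := by
  obtain ⟨w, ws, wl, wm⟩ := h
  let W : Fin k → Sym2 V → ℕ := fun c => Sym2.lift ⟨w c, ws c⟩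
  have hW : ∀ e, ∑ a, W a e = G.doubled.mult e := by
    intro e
    induction e with
    | h u v =>
      simpa [W, SimpleGraph.doubled, dbl] using wm u v
  choose c hc using fun e => exists_fin_coloring (fun a => W a e) (hW e)
  refine ⟨fun x => c x.1 x.2, fun a => ?_⟩
  have hm : ∀ e, (G.doubled.colorClass (fun x => c x.1 x.2) a).mult e = W a e := fun e => by
    rw [← hc e a]
    rfl
  intro u v huv
  have h1 := wl a u v (by simpa [Multigraph.Adj, hm, W] using huv)
  simpa [Multigraph.degree, hm, W, wdeg] using h1

/-! ### Subgraphs with prescribed degree parities -/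

/-- Count the traversals of each edge by a walk modulo 2: inner visits cancel and only the endpoints
remain. -/
theorem exists_path_weight {G : SimpleGraph V} {u v : V} (h : G.Reachable u v) :
    ∃ z : V → V → ZMod 2, (∀ x y, z x y = z y x) ∧ (∀ x y, z x y ≠ 0 → G.Adj x y) ∧
      ∀ x, ∑ y, z x y = (if x = u then 1 else 0) + (if x = v then 1 else 0) := by
  obtain ⟨p⟩ := h
  induction p with
  | nil => exact ⟨fun _ _ => 0, by simp, by simp, fun x => by simp [CharTwo.add_self_eq_zero]⟩
  | @cons u v w huv p ih =>
    obtain ⟨z, zs, za, zb⟩ := ih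
    have hne := huv.ne
    refine ⟨fun x y => z x y + ((if x = u ∧ y = v then 1 else 0) + if x = v ∧ y = u then 1 else 0),
      fun x y => ?_, fun x y hxy => ?_, fun x => ?_⟩
    · beta_reduce
      rw [zs x y, add_comm (ite (x = u ∧ y = v) _ _)]
      simp only [and_comm]
    · by_cases hz : z x y = 0
      · beta_reduce at hxy
        rw [hz, zero_add] at hxy
        by_cases h1 : x = u ∧ y = v
        · rw [h1.1, h1.2]; exact huv
        · by_cases h2 : x = v ∧ y = u
          · rw [h2.1, h2.2]; exact huv.symm
          · simp [h1, h2] at hxy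
      · exact za x y hz
    · have e1 : ∀ a b : V, ∑ y, (if x = a ∧ y = b then (1 : ZMod 2) else 0) =
          if x = a then 1 else 0 := fun a b => by
        by_cases hx : x = a <;> simp [hx]
      rw [sum_add_distrib, sum_add_distrib, zb, e1, e1]
      have h2 : ∀ a : ZMod 2, a + a = 0 := CharTwo.add_self_eq_zero
      linear_combination h2 (if x = v then 1 else 0)

/-- A subgraph with prescribed degree parities, up to corrections at representatives. -/
theorem exists_parity_subgraph (G : SimpleGraph V) (f : V → ZMod 2) (rep : V → V)
    (h : ∀ v, f v ≠ 0 → G.Reachable v (rep v)) :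
    ∃ J : V → V → ℕ, (∀ x y, J x y = J y x) ∧ (∀ x y, J x y ≤ 1) ∧
      (∀ x y, J x y ≠ 0 → G.Adj x y) ∧
      ∀ x, (wdeg J x : ZMod 2) = f x + ∑ v with rep v = x, f v := by
  have h' : ∀ v, ∃ z : V → V → ZMod 2, (∀ x y, z x y = z y x) ∧ (∀ x y, z x y ≠ 0 → G.Adj x y) ∧
      (f v ≠ 0 → ∀ x, ∑ y, z x y = (if x = v then 1 else 0) + (if x = rep v then 1 else 0)) := by
    intro v
    by_cases hv : f v = 0
    · exact ⟨fun _ _ => 0, by simp, by simp, fun h => absurd hv h⟩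
    · obtain ⟨z, h1, h2, h3⟩ := exists_path_weight (h v hv)
      exact ⟨z, h1, h2, fun _ => h3⟩
  choose z zs za zb using h'
  -- Superpose modulo 2 the paths from each `v` with `f v = 1` to `rep v`; the far ends of the paths
  -- cause the correction term.
  refine ⟨fun x y => (∑ v, f v * z v x y).val, fun x y => ?_, fun x y => ?_, fun x y hxy => ?_,
    fun x => ?_⟩
  · simp only [zs _ x y]
  · exact Nat.lt_succ_iff.mp (ZMod.val_lt _)
  · by_contra hn
    apply hxy
    have : ∀ v, z v x y = 0 := fun v => by_contra fun h0 => hn (za v x y h0)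
    simp [this]
  · have e : ∀ v, ∑ y, f v * z v x y =
        f v * (if x = v then 1 else 0) + f v * (if rep v = x then 1 else 0) := by
      intro v
      by_cases hv : f v = 0
      · simp [hv]
      · rw [← mul_sum, zb v hv, mul_add, eq_comm (a := x) (b := rep v)]
    simp only [wdeg, Nat.cast_sum, ZMod.natCast_val, ZMod.cast_id', id_eq]
    rw [sum_comm]
    simp only [e, sum_add_distrib, mul_ite, mul_one, mul_zero, sum_ite_eq, mem_univ, if_true]
    rw [sum_filter]

/-! ### Bipartite graphs -/

/-- All vertices reachable from `r` other than a farthest one stay reachable when the edges at the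
farthest vertex are deleted. -/
theorem exists_farthest (G : SimpleGraph V) (r : V) :
    ∃ y, G.Reachable r y ∧ (∀ v, G.Reachable r v → G.dist r v ≤ G.dist r y) := by
  obtain ⟨y, hy, hmax⟩ := exists_max_image (univ.filter fun v => G.Reachable r v)
    (fun v => G.dist r v) ⟨r, by simp⟩
  exact ⟨y, (mem_filter.mp hy).2, fun v hv => hmax v (by simp [hv])⟩

/-- The predecessor on a shortest path from `r` is strictly closer to `r` than its successor, hence
is not the farthest vertex `y`; induct on the distance. -/
theorem reachable_avoiding {V : Type*} {G G' : SimpleGraph V} {r y : V} {P : V → Prop}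
    (hmax : ∀ v, G.Reachable r v → G.dist r v ≤ G.dist r y)
    (hP : ∀ v, G.Reachable r v → P v → v = y)
    (hG' : ∀ u v, G.Adj u v → ¬ P u → ¬ P v → G'.Adj u v) :
    ∀ v, G.Reachable r v → ¬ P v → G'.Reachable v r := by
  suffices h : ∀ n v, G.Reachable r v → G.dist r v = n → ¬ P v → G'.Reachable v r from
    fun v hv hp => h _ v hv rfl hp
  intro n
  induction n with
  | zero =>
    intro v hv hd _
    rw [hv.dist_eq_zero_iff] at hd
    rw [hd]
  | succ n ih =>
    intro v hv hd hp
    obtain ⟨u, hu, hdu⟩ : ∃ u, G.Adj u v ∧ G.dist r u = n := by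
      obtain ⟨p, hpl⟩ := hv.symm.exists_walk_length_eq_dist
      rw [SimpleGraph.dist_comm, hd] at hpl
      cases p with
      | nil => simp at hpl
      | @cons _ u _ huv q =>
        refine ⟨u, huv.symm, ?_⟩
        have h1 : G.dist r u ≤ n := by
          rw [SimpleGraph.dist_comm]
          exact (SimpleGraph.dist_le q).trans (by simpa using hpl.le)
        have h2 := (huv.symm.reachable : G.Reachable u v)
        obtain ⟨q', hq'⟩ := (q.reachable.symm).exists_walk_length_eq_dist
        have h3 := SimpleGraph.dist_le (q'.concat huv.symm)
        rw [SimpleGraph.Walk.length_concat, hq', hd] at h3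
        omega
    have hru : G.Reachable r u := hv.trans hu.symm.reachable
    have hpu : ¬ P u := fun hPu => by
      have h1 := hP u hru hPu
      have h2 := hmax v hv
      rw [← h1] at h2
      omega
    exact ((hG' u v hu hpu hp).symm.reachable).trans (ih u hru hdu hpu)

/-- Data needed to distinguish the two sides of a bipartite graph by parities: `Z` is a set of
exceptional vertices, at most one in each component. -/
theorem exists_bipartite_parity (G : SimpleGraph V) (side : V → Bool) :
    ∃ (Z : V → Prop) (f : V → ZMod 2) (J : V → V → ℕ),
      (∀ x y, Z x → Z y → G.Reachable x y → x = y) ∧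
      (∀ x y, G.Adj x y → side x ≠ side y → ¬ Z x → ¬ Z y → f x ≠ f y) ∧
      (∀ x y, J x y = J y x) ∧ (∀ x y, J x y ≤ 1) ∧
      (∀ x y, J x y ≠ 0 → G.Adj x y ∧ ¬ Z x ∧ ¬ Z y) ∧
      ∀ x, (wdeg J x : ZMod 2) = f x := by
  let rep : V → V := fun v => (G.connectedComponentMk v).out
  have hrep : ∀ v, G.Reachable (rep v) v := fun v =>
    SimpleGraph.ConnectedComponent.exact (Quot.out_eq (G.connectedComponentMk v))
  have hrep' : ∀ u v, G.Reachable u v → rep u = rep v := fun u v h => by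
    simp only [rep, SimpleGraph.ConnectedComponent.sound h]
  choose far hfar hmax using exists_farthest G
  -- In a bad component both sides are odd, so neither can be the set of odd-degree vertices.
  -- Removing a farthest vertex makes its own side even, and `sg` then selects that side.
  let bad : V → Prop := fun r => ∀ s, ¬ Even (#{v | G.Reachable r v ∧ side v = s})
  let Z : V → Prop := fun v => bad (rep v) ∧ v = far (rep v)
  have hsg : ∀ r, ∃ s, (bad r → s = side (far r)) ∧
      (¬ bad r → Even (#{v | G.Reachable r v ∧ side v = s})) := fun r => by
    by_cases hb : bad r
    · exact ⟨_, fun _ => rfl, fun h => absurd hb h⟩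
    · have hb' := hb
      simp only [bad, not_forall, not_not] at hb'
      obtain ⟨s, hs⟩ := hb'
      exact ⟨s, fun h => absurd h hb, fun _ => hs⟩
  choose sg sg1 sg2 using hsg
  let f : V → ZMod 2 := fun v => if ¬ Z v ∧ side v = sg (rep v) then 1 else 0
  let G' : SimpleGraph V :=
    { Adj := fun x y => G.Adj x y ∧ ¬ Z x ∧ ¬ Z y
      symm := ⟨fun x y h => ⟨h.1.symm, h.2.2, h.2.1⟩⟩
      loopless := ⟨fun x h => G.loopless.irrefl x h.1⟩ }
  obtain ⟨J, Js, J1, Ja, Jp⟩ := exists_parity_subgraph G' f rep (fun v hv => by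
    have hz : ¬ Z v := fun hz => hv (by simp [f, hz])
    refine reachable_avoiding (G := G) (r := rep v) (y := far (rep v)) (P := Z) (hmax _) ?_
      (fun a b h1 h2 h3 => (⟨h1, h2, h3⟩ : G.Adj a b ∧ ¬ Z a ∧ ¬ Z b)) v (hrep v) hz
    intro u hu hzu
    have := hrep' u v (hu.symm.trans (hrep v))
    rw [hzu.2, this])
  refine ⟨Z, f, J, fun x y hx hy hxy => ?_, fun x y hxy hs hx hy => ?_, Js, J1, Ja, fun x => ?_⟩
  · rw [hx.2, hy.2, hrep' x y hxy]
  · have := hrep' x y hxy.reachable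
    simp only [f, hx, hy, this, not_false_eq_true, true_and]
    revert hs
    generalize side x = a, side y = b, sg (rep y) = c
    revert a b c
    decide
  -- The correction at a representative is the parity of the selected side without exceptional
  -- vertices, which is even by the choice of `sg`.
  · rw [Jp, add_eq_left]
    by_cases hx : rep x = x
    swap
    · apply sum_eq_zero
      intro v hv
      exfalso
      apply hx
      rw [mem_filter] at hv
      have h1 := hrep' (rep v) v (hrep v)
      rw [hv.2] at h1
      exact h1
    have hmem : ∀ v, rep v = x ↔ G.Reachable x v := fun v =>
      ⟨fun h => h ▸ hrep v, fun h => by rw [← hrep' x v h, hx]⟩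
    rw [sum_boole, filter_filter]
    rw [ZMod.natCast_eq_zero_iff_even]
    have hset : (univ.filter fun v => rep v = x ∧ ¬ Z v ∧ side v = sg (rep v)) =
        univ.filter fun v => (G.Reachable x v ∧ side v = sg x) ∧ ¬ Z v := by
      ext v
      simp only [mem_filter, mem_univ, true_and, ← hmem]
      constructor
      · rintro ⟨rfl, h1, h2⟩
        exact ⟨⟨rfl, h2⟩, h1⟩
      · rintro ⟨⟨rfl, h2⟩, h1⟩
        exact ⟨rfl, h1, h2⟩
    rw [hset]
    by_cases hb : bad x
    · have hZ : ∀ v, G.Reachable x v → (Z v ↔ v = far x) := fun v hv => by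
        have := (hmem v).2 hv
        simp [Z, this, hb]
      have he : (univ.filter fun v => (G.Reachable x v ∧ side v = sg x) ∧ ¬ Z v) =
          (univ.filter fun v => G.Reachable x v ∧ side v = sg x).erase (far x) := by
        ext v
        simp only [mem_filter, mem_univ, true_and, mem_erase]
        constructor
        · rintro ⟨h1, h2⟩
          exact ⟨fun h => h2 ((hZ v h1.1).2 h), h1⟩
        · rintro ⟨h1, h2⟩
          exact ⟨h2, fun h => h1 ((hZ v h2.1).1 h)⟩
      rw [he, card_erase_of_mem (by simp [hfar x, sg1 x hb])]
      have := hb (sg x)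
      rw [Nat.not_even_iff_odd] at this
      exact Nat.Odd.sub_odd this odd_one
    · have he : (univ.filter fun v => (G.Reachable x v ∧ side v = sg x) ∧ ¬ Z v) =
          (univ.filter fun v => G.Reachable x v ∧ side v = sg x) := by
        refine filter_congr fun v _ => and_iff_left_of_imp fun h hz => hb ?_
        have := hz.1
        rwa [(hmem v).2 h.1] at this
      rw [he]
      exact sg2 x hb

theorem four_le_wdeg_dbl {G : SimpleGraph V} {u v w : V} (h : G.Adj u v) (h' : G.Adj u w)
    (hvw : v ≠ w) : 4 ≤ wdeg (dbl G) u := by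
  have := sum_le_sum_of_subset (f := fun x => dbl G u x) (subset_univ {v, w})
  rw [sum_pair hvw] at this
  simp only [dbl, h, h', if_true] at this
  simpa only [wdeg, dbl] using this

theorem wdeg_eq_single {w : V → V → ℕ} {u v : V} (h : ∀ x, x ≠ v → w u x = 0) :
    wdeg w u = w u v :=
  sum_eq_single v (fun x _ hx => h x hx) (by simp)

/-- A bipartite graph without isolated edges, doubled, splits into three locally irregular
weightings. -/
theorem decomp_bipartite (G : SimpleGraph V) (side : V → Bool)
    (hs : ∀ u v, G.Adj u v → side u ≠ side v)
    (hK : ∀ u v, G.Adj u v → (∃ x, x ≠ v ∧ G.Adj u x) ∨ ∃ x, x ≠ u ∧ G.Adj v x) :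
    Decomp 3 (dbl G) := by
  obtain ⟨Z, f, J, hZ, hf, Js, J1, Ja, Jp⟩ := exists_bipartite_parity G side
  -- An exceptional vertex with two neighbors gives its whole doubled star to `g`; an exceptional
  -- leaf keeps its edge in `α`.
  let B : V → Prop := fun u => Z u ∧ ∃ x y, x ≠ y ∧ G.Adj u x ∧ G.Adj u y
  let g : V → V → ℕ := fun u v => if G.Adj u v ∧ (B u ∨ B v) then 2 else 0
  have gs : ∀ u v, g u v = g v u := fun u v => by
    simp only [g, G.adj_comm u v, or_comm]
  have hle : ∀ u v, J u v + g u v ≤ dbl G u v := fun u v => by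
    by_cases hj : J u v = 0
    · rw [hj, zero_add]
      simp only [g, dbl]
      split_ifs <;> simp_all
    · obtain ⟨h1, h2, h3⟩ := Ja u v hj
      have : g u v = 0 := by simp [g, B, h2, h3]
      have h4 := J1 u v
      simp [this, dbl, h1]
      omega
  let α : V → V → ℕ := fun u v => dbl G u v - J u v - g u v
  have hα : ∀ u v, α u v + J u v + g u v = dbl G u v := fun u v => by
    have := hle u v
    simp only [α]
    omega
  have αs : ∀ u v, α u v = α v u := fun u v => by
    simp only [α, Js u v, gs u v, dbl_comm G u v]
  have hdeg : ∀ v, wdeg α v + wdeg J v + wdeg g v = wdeg (dbl G) v := fun v => by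
    simp only [wdeg, ← sum_add_distrib, hα]
  have even_of : ∀ h : V → V → ℕ, (∀ u v, Even (h u v)) → ∀ v, Even (wdeg h v) := fun h hh v =>
    even_sum _ fun u _ => hh v u
  have hge : ∀ v, Even (wdeg g v) := even_of g fun u v => by simp only [g]; split_ifs <;> simp
  have hde : ∀ v, Even (wdeg (dbl G) v) :=
    even_of _ fun u v => by simp only [dbl]; split_ifs <;> simp
  -- The doubled graph and `g` have even degrees, so `α` has the same degree parities as `J`.
  have hαp : ∀ v, (wdeg α v : ZMod 2) = f v := fun v => by
    have h1 := congrArg (Nat.cast (R := ZMod 2)) (hdeg v)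
    push_cast at h1
    rw [(ZMod.natCast_eq_zero_iff_even).2 (hge v), (ZMod.natCast_eq_zero_iff_even).2 (hde v),
      Jp, add_zero] at h1
    rwa [CharTwo.add_eq_zero] at h1
  have gadj : ∀ u v, 0 < g u v → G.Adj u v ∧ (B u ∨ B v) := fun u v h => by
    by_contra hn
    simp [g, hn] at h
  have αadj : ∀ u v, 0 < α u v → G.Adj u v := fun u v h => by
    by_contra hn
    simp [α, dbl, hn] at h
  -- A component has at most one exceptional vertex, so `g` is a union of disjoint doubled stars:
  -- leaves have degree 2, centers at least 4.
  have gli : ∀ u v, 0 < g u v → B u → wdeg g v < wdeg g u := by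
    intro u v huv hu
    have hadj := (gadj u v huv).1
    have h2 : wdeg g v = g v u := wdeg_eq_single fun x hx => by
      by_contra h0
      obtain ⟨h1, h2⟩ := gadj v x (Nat.pos_of_ne_zero h0)
      rcases h2 with h2 | h2
      · exact hadj.ne (hZ _ _ hu.1 h2.1 hadj.reachable)
      · exact hx (hZ _ _ h2.1 hu.1 (h1.symm.reachable.trans hadj.symm.reachable))
    have h3 : wdeg g u = wdeg (dbl G) u := by
      refine sum_congr rfl fun x _ => ?_
      simp only [g, dbl, hu, true_or, and_true]
    obtain ⟨x, y, hxy, hx, hy⟩ := hu.2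
    have h4 := four_le_wdeg_dbl hx hy hxy
    have h5 : g v u ≤ 2 := by
      simp only [g]
      split_ifs <;> simp
    omega
  have gLI : IsLI g := fun u v h => by
    rcases (gadj u v h).2 with h1 | h1
    · exact (gli u v h h1).ne'
    · exact (gli v u (gs u v ▸ h) h1).ne
  have JLI : IsLI J := fun u v h heq => by
    obtain ⟨h1, h2, h3⟩ := Ja u v h.ne'
    exact hf u v h1 (hs u v h1) h2 h3 (by rw [← Jp, ← Jp, heq])
  -- The exceptional leaf `u` has its neighbor `v` as its only neighbor. As the edge is not
  -- isolated, `v` has a second edge, of which `J` takes at most one copy, so `v` has larger degree.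
  have key : ∀ u v, 0 < α u v → Z u → wdeg α u < wdeg α v := by
    intro u v huv hu
    have hadj := αadj u v huv
    have hBu : ¬ B u := fun hB => by
      have h1 := hα u v
      simp only [g, hadj, hB, dbl, true_or, and_self, if_true] at h1
      omega
    have hone : ∀ x, G.Adj u x → x = v := fun x hx => by
      by_contra hne
      exact hBu ⟨hu, x, v, hne, hx, hadj⟩
    have h1 : wdeg α u = α u v := wdeg_eq_single fun x hx => by
      by_contra h0
      exact hx (hone x (αadj u x (Nat.pos_of_ne_zero h0)))
    have hJ : J u v = 0 := by
      by_contra h0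
      exact (Ja u v h0).2.1 hu
    obtain ⟨x, hxu, hx⟩ : ∃ x, x ≠ u ∧ G.Adj v x := by
      rcases hK u v hadj with ⟨x, hx, hux⟩ | h
      · exact absurd (hone x hux) hx
      · exact h
    have hg : g v x = 0 := by
      by_contra h0
      obtain ⟨_, h2⟩ := gadj v x (Nat.pos_of_ne_zero h0)
      rcases h2 with h2 | h2
      · exact hadj.ne (hZ _ _ hu h2.1 hadj.reachable)
      · exact hxu (hZ _ _ h2.1 hu (hx.symm.reachable.trans hadj.symm.reachable))
    have h3 : 1 ≤ α v x := by
      have h4 := hα v x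
      have h5 := J1 v x
      simp only [dbl, hx, if_true] at h4
      omega
    have h6 := sum_le_sum_of_subset (f := fun y => α v y) (subset_univ {u, x})
    rw [sum_pair hxu.symm] at h6
    rw [h1, αs u v]
    simp only [wdeg]
    omega
  have αLI : IsLI α := fun u v h => by
    by_cases hu : Z u
    · exact (key u v h hu).ne
    by_cases hv : Z v
    · exact (key v u (αs u v ▸ h) hv).ne'
    intro heq
    have h1 := αadj u v h
    exact hf u v h1 (hs u v h1) hu hv (by rw [← hαp, ← hαp, heq])
  exact (((Decomp.single αs αLI).add (Decomp.single Js JLI)).add (Decomp.single gs gLI)).congr hα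

/-! ### Connected graphs with 32 colors -/

/-- An orientation of a connected graph with even out-degrees outside a root. -/
theorem exists_even_orientation (G : SimpleGraph V) (hG : G.Preconnected) (r : V) :
    ∃ O : V → Finset V, (∀ u v, v ∈ O u → u ∉ O v) ∧ (∀ u v, G.Adj u v ↔ v ∈ O u ∨ u ∈ O v) ∧
      ∀ v, v ≠ r → Even (#(O v)) := by
  let e := Fintype.equivFin V
  -- Orient along an enumeration, then reverse the edges of a T-join for the vertices of odd
  -- out-degree; each reversal flips the parity at both ends.
  let o : V → V → Prop := fun u v => G.Adj u v ∧ e u < e v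
  obtain ⟨J, Js, J1, Ja, Jp⟩ := exists_parity_subgraph G (fun v => (#{u | o v u} : ZMod 2))
    (fun _ => r) (fun v _ => hG v r)
  have hlt : ∀ u v, G.Adj u v → (e u < e v ↔ ¬ e v < e u) := fun u v h => by
    have : e u ≠ e v := fun h' => h.ne (e.injective h')
    rw [not_lt]
    exact ⟨le_of_lt, fun h => lt_of_le_of_ne h this⟩
  refine ⟨fun u => univ.filter fun v => G.Adj u v ∧ (e u < e v ↔ J u v = 0), ?_, ?_, ?_⟩
  · intro u v
    simp only [mem_filter, mem_univ, true_and]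
    rintro ⟨h1, h2⟩ ⟨_, h3⟩
    rw [Js v u] at h3
    have := hlt u v h1
    tauto
  · intro u v
    simp only [mem_filter, mem_univ, true_and, Js v u, G.adj_comm v u]
    constructor
    · intro h
      have := hlt u v h
      tauto
    · tauto
  · intro v hv
    have h1 := Jp v
    rw [filter_false_of_mem (fun x _ => hv.symm), sum_empty, add_zero] at h1
    rw [← ZMod.natCast_eq_zero_iff_even, ← sum_boole]
    have h2 : ∀ u, (if G.Adj v u ∧ (e v < e u ↔ J v u = 0) then (1 : ZMod 2) else 0) =
        (if o v u then 1 else 0) + (J v u : ZMod 2) := by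
      intro u
      by_cases h : G.Adj v u
      · have h01 : J v u = 0 ∨ J v u = 1 := by have := J1 v u; omega
        rcases h01 with hj | hj <;> by_cases hl : e v < e u <;> simp [h, o, hj, hl]
        decide
      · have : J v u = 0 := by_contra fun h0 => h (Ja v u h0)
        simp [h, o, this]
    rw [sum_congr rfl fun u _ => h2 u, sum_add_distrib, sum_boole]
    simp only [wdeg, Nat.cast_sum] at h1
    rw [h1]
    exact CharTwo.add_self_eq_zero _

/-- A family of fifteen bipartitions separating any color from any two other colors. -/
theorem exists_separating_bipartitions : ∃ χ : Fin 15 → (Fin 5 → Bool) → Bool,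
    ∀ a b c, b ≠ a → c ≠ a → ∃ i, χ i b ≠ χ i a ∧ χ i c ≠ χ i a := by
  -- The five coordinates and the ten sums of two coordinates. If `b` differs from `a` at `i`, `c`
  -- differs from `a` at `j`, and neither coordinate serves both, their sum does.
  let I := {p : Fin 5 × Fin 5 // p.1 ≤ p.2}
  have hI : Fintype.card I = 15 := by decide
  let E : Fin 15 ≃ I := (Fintype.equivFinOfCardEq hI).symm
  let χ : I → (Fin 5 → Bool) → Bool := fun p a =>
    if p.1.1 = p.1.2 then a p.1.1 else xor (a p.1.1) (a p.1.2)
  suffices h : ∀ a b c : Fin 5 → Bool, b ≠ a → c ≠ a →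
      ∃ p : I, χ p b ≠ χ p a ∧ χ p c ≠ χ p a by
    refine ⟨fun i => χ (E i), fun a b c hb hc => ?_⟩
    obtain ⟨p, hp⟩ := h a b c hb hc
    exact ⟨E.symm p, by simpa using hp⟩
  intro a b c hb hc
  obtain ⟨i, hi⟩ := Function.ne_iff.mp hb
  obtain ⟨j, hj⟩ := Function.ne_iff.mp hc
  by_cases h1 : c i = a i
  swap
  · exact ⟨⟨(i, i), le_rfl⟩, by simpa [χ] using ⟨hi, h1⟩⟩
  by_cases h2 : b j = a j
  swap
  · exact ⟨⟨(j, j), le_rfl⟩, by simpa [χ] using ⟨h2, hj⟩⟩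
  have hij : i ≠ j := fun h => hi (h ▸ h2)
  rcases le_total i j with h | h
  · exact ⟨⟨(i, j), h⟩, by simpa [χ, hij, h1, h2] using ⟨hi, hj⟩⟩
  · exact ⟨⟨(j, i), h⟩, by simpa [χ, hij.symm, h1, h2] using ⟨hi, hj⟩⟩

/-- A finite set of even size can be paired up so that the members of a pair share a label. -/
theorem exists_paired_labels {W I : Type*} [Nonempty I] (P : I → W → Prop) (O : Finset W)
    (hO : Even (#O)) (hP : ∀ u ∈ O, ∀ v ∈ O, ∃ i, P i u ∧ P i v) :
    ∃ g : W → I, ∀ u ∈ O, P (g u) u ∧ ∃ v ∈ O, v ≠ u ∧ g v = g u := by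
  obtain ⟨n, hn⟩ := hO
  induction n generalizing O with
  | zero =>
    have : O = ∅ := card_eq_zero.mp (by omega)
    exact ⟨fun _ => Classical.arbitrary I, by simp [this]⟩
  | succ n ih =>
    obtain ⟨a, ha, b, hb, hab⟩ := one_lt_card.mp (show 1 < #O by omega)
    have hb' : b ∈ O.erase a := mem_erase.mpr ⟨hab.symm, hb⟩
    have hsub : ∀ u, u ∈ (O.erase a).erase b ↔ u ≠ b ∧ u ≠ a ∧ u ∈ O := by simp
    obtain ⟨g, hg⟩ := ih ((O.erase a).erase b)
      (fun u hu v hv => hP u ((hsub u).1 hu).2.2 v ((hsub v).1 hv).2.2)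
      (by rw [card_erase_of_mem hb', card_erase_of_mem ha]; omega)
    obtain ⟨i, hia, hib⟩ := hP a ha b hb
    refine ⟨fun u => if u = a ∨ u = b then i else g u, fun u hu => ?_⟩
    by_cases hua : u = a
    · subst hua
      exact ⟨by simpa using hia, b, hb, hab.symm, by simp⟩
    by_cases hub : u = b
    · subst hub
      exact ⟨by simpa using hib, a, ha, hab, by simp⟩
    obtain ⟨h1, v, hv, hvu, hgv⟩ := hg u ((hsub u).2 ⟨hub, hua, hu⟩)
    obtain ⟨h2, h3, h4⟩ := (hsub v).1 hv
    exact ⟨by simpa [hua, hub] using h1, v, h4, hvu, by simpa [hua, hub, h2, h3] using hgv⟩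

/-- The doubled graph of a family of out-neighborhoods. -/
noncomputable def outDbl (O : V → Finset V) (x y : V) : ℕ :=
  (if y ∈ O x then 2 else 0) + if x ∈ O y then 2 else 0

/-- Each arc goes to the bipartition that separates its pair of out-neighbors from the tail. The
partner arc shares the tail, so no edge is isolated, and each of the 15 bipartite graphs costs 3. -/
theorem decomp_outDbl (O : V → Finset V) (hO : ∀ u v, v ∈ O u → u ∉ O v)
    (he : ∀ v, Even (#(O v))) (φ : V → Fin 5 → Bool) (hφ : ∀ u v, v ∈ O u → φ v ≠ φ u) :
    Decomp 45 (outDbl O) := by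
  obtain ⟨χ, hχ⟩ := exists_separating_bipartitions
  have h := fun c => exists_paired_labels (fun i u => χ i (φ u) ≠ χ i (φ c)) (O c) (he c)
    fun u hu v hv => hχ _ _ _ (hφ c u hu) (hφ c v hv)
  choose g hg using h
  let H : Fin 15 → SimpleGraph V := fun i =>
    { Adj := fun x y => (y ∈ O x ∧ g x y = i) ∨ (x ∈ O y ∧ g y x = i)
      symm := ⟨fun x y h => h.symm⟩
      loopless := ⟨fun x h => by
        have : x ∈ O x := h.elim And.left And.left
        exact hO x x this this⟩ }
  have hH : ∀ i x y, (H i).Adj x y ↔ (y ∈ O x ∧ g x y = i) ∨ (x ∈ O y ∧ g y x = i) :=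
    fun _ _ _ => Iff.rfl
  refine (Decomp.sum (n := 15) (m := fun i => dbl (H i)) fun i =>
    decomp_bipartite (H i) (fun v => χ i (φ v)) ?_ ?_).congr fun x y => ?_
  · rintro u v (⟨h1, rfl⟩ | ⟨h1, rfl⟩)
    · exact ((hg u v h1).1).symm
    · exact (hg v u h1).1
  · rintro u v (⟨h1, rfl⟩ | ⟨h1, rfl⟩)
    · obtain ⟨_, x, hx, hxv, hgx⟩ := hg u v h1
      exact Or.inl ⟨x, hxv, Or.inl ⟨hx, hgx⟩⟩
    · obtain ⟨_, x, hx, hxv, hgx⟩ := hg v u h1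
      exact Or.inr ⟨x, hxv, Or.inl ⟨hx, hgx⟩⟩
  · simp only [dbl, hH, outDbl]
    by_cases h1 : y ∈ O x
    · simp [h1, hO x y h1]
    · by_cases h2 : x ∈ O y <;> simp [h1, h2]

/-- The weighting with a single edge of weight one. -/
noncomputable def edgeWeight (a b x y : V) : ℕ :=
  (if x = a ∧ y = b then 1 else 0) + if x = b ∧ y = a then 1 else 0

theorem wdeg_edgeWeight (a b x : V) :
    wdeg (edgeWeight a b) x = (if x = a then 1 else 0) + if x = b then 1 else 0 := by
  have e1 : ∀ a b : V, ∑ y, (if x = a ∧ y = b then 1 else 0) = if x = a then 1 else 0 :=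
    fun a b => by by_cases hx : x = a <;> simp [hx]
  simp only [wdeg, edgeWeight, sum_add_distrib, e1]

/-- A path on two edges of weights two and one is locally irregular. -/
theorem decomp_path {a b c : V} (hab : a ≠ b) (hbc : b ≠ c) (hac : a ≠ c) :
    Decomp 1 (fun x y => 2 * edgeWeight a b x y + edgeWeight b c x y) := by
  -- The degrees at `a`, `b`, `c` are 2, 3, 1.
  refine Decomp.single (fun u v => ?_) (fun u v h => ?_)
  · simp only [edgeWeight, and_comm (a := v = _)]
    omega
  · have hw : ∀ x, wdeg (fun x y => 2 * edgeWeight a b x y + edgeWeight b c x y) x =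
        2 * wdeg (edgeWeight a b) x + wdeg (edgeWeight b c) x := fun x => by
      simp only [wdeg, sum_add_distrib, mul_sum]
    have hcase : (u = a ∧ v = b) ∨ (u = b ∧ v = a) ∨ (u = b ∧ v = c) ∨ (u = c ∧ v = b) := by
      by_contra hn
      simp only [not_or] at hn
      simp [edgeWeight, hn] at h
    rw [hw, hw]
    simp only [wdeg_edgeWeight]
    rcases hcase with ⟨rfl, rfl⟩ | ⟨rfl, rfl⟩ | ⟨rfl, rfl⟩ | ⟨rfl, rfl⟩ <;>
      simp [hab, hbc, hac, hab.symm, hbc.symm, hac.symm]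

/-- Deleting an out-neighbor. -/
noncomputable def eraseOut (O : V → Finset V) (c u : V) : V → Finset V :=
  fun v => if v = c then (O v).erase u else O v

theorem mem_eraseOut {V : Type*} {O : V → Finset V} {c u x y : V} :
    y ∈ eraseOut O c u x ↔ y ∈ O x ∧ ¬ (x = c ∧ y = u) := by
  by_cases h : x = c <;> simp [eraseOut, h, and_comm]

theorem card_eraseOut_self {V : Type*} {O : V → Finset V} {c u : V} (h : u ∈ O c) :
    #(eraseOut O c u c) + 1 = #(O c) := by
  simp only [eraseOut, if_true]
  exact card_erase_add_one h

theorem eraseOut_of_ne {V : Type*} {O : V → Finset V} {c u v : V} (h : v ≠ c) : eraseOut O c u v = O v := by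
  simp [eraseOut, h]

theorem outDbl_eraseOut {V : Type*} {O : V → Finset V} {c u : V} (h : u ∈ O c) (x y : V) :
    outDbl (eraseOut O c u) x y + 2 * edgeWeight c u x y = outDbl O x y := by
  have key : ∀ x y, (if y ∈ eraseOut O c u x then 2 else 0) +
      2 * (if x = c ∧ y = u then 1 else 0) = if y ∈ O x then 2 else 0 := fun x y => by
    simp only [mem_eraseOut]
    by_cases h1 : x = c ∧ y = u
    · simp [h1, h]
    · by_cases h2 : y ∈ O x <;> simp [h1, h2]
  have h1 := key x y
  have h2 := key y x
  simp only [outDbl, edgeWeight, and_comm (a := x = u)]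
  omega

/-- A connected graph of bounded chromatic number without isolated edges, doubled. -/
theorem decomp_of_coloring (G : SimpleGraph V) (hG : G.Preconnected) (φ : V → Fin 5 → Bool)
    (hφ : ∀ u v, G.Adj u v → φ u ≠ φ v)
    (hK : ∀ u v, G.Adj u v → (∃ x, x ≠ v ∧ G.Adj u x) ∨ ∃ x, x ≠ u ∧ G.Adj v x) :
    Decomp 47 (dbl G) := by
  rcases isEmpty_or_nonempty V with hV | ⟨⟨r⟩⟩
  · exact ((Decomp.zero (V := V)).mono (Nat.zero_le 47)).congr fun u => hV.elim u
  obtain ⟨O, hO, hadj, hev⟩ := exists_even_orientation G hG r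
  have hdbl : ∀ x y, outDbl O x y = dbl G x y := fun x y => by
    simp only [outDbl, dbl, hadj]
    by_cases h1 : y ∈ O x
    · simp [h1, hO x y h1]
    · simp [h1]
  have hφO : ∀ u v, v ∈ O u → φ v ≠ φ u := fun u v h => (hφ u v ((hadj u v).2 (Or.inl h))).symm
  by_cases hr : Even (#(O r))
  · refine ((decomp_outDbl O hO (fun v => ?_) φ hφO).mono (by norm_num)).congr hdbl
    by_cases h : v = r
    · rwa [h]
    · exact hev v h
  rw [Nat.not_even_iff_odd] at hr
  obtain ⟨w, hw⟩ := card_pos.mp hr.pos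
  have hrw : G.Adj r w := (hadj r w).2 (Or.inl hw)
  -- Dropping `r w` makes every out-degree even, but a doubled edge alone is not locally irregular;
  -- it borrows one copy of an adjacent edge `p x`.
  let O₁ := eraseOut O r w
  have hev₁ : ∀ v, Even (#(O₁ v)) := fun v => by
    by_cases h : v = r
    · subst h
      have h1 := card_eraseOut_self hw
      obtain ⟨k, hk⟩ := hr
      exact ⟨k, by simp only [O₁]; omega⟩
    · simp only [O₁, eraseOut_of_ne h]
      exact hev v h
  obtain ⟨q, p, x, hqp, hpx, hqx, hpxa⟩ : ∃ q p x, (q = r ∧ p = w ∨ q = w ∧ p = r) ∧ p ≠ x ∧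
      q ≠ x ∧ G.Adj p x := by
    rcases hK r w hrw with ⟨x, hx, h⟩ | ⟨x, hx, h⟩
    · exact ⟨w, r, x, Or.inr ⟨rfl, rfl⟩, h.ne, hx.symm, h⟩
    · exact ⟨r, w, x, Or.inl ⟨rfl, rfl⟩, h.ne, hx.symm, h⟩
  have hqpne : q ≠ p := by
    rcases hqp with ⟨rfl, rfl⟩ | ⟨rfl, rfl⟩
    · exact hrw.ne
    · exact hrw.ne'
  obtain ⟨c, u, hcu, hu⟩ : ∃ c u, (c = p ∧ u = x ∨ c = x ∧ u = p) ∧ u ∈ O₁ c := by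
    have hxw : x ≠ r ∧ x ≠ w := by
      rcases hqp with ⟨rfl, rfl⟩ | ⟨rfl, rfl⟩
      · exact ⟨hqx.symm, hpx.symm⟩
      · exact ⟨hpx.symm, hqx.symm⟩
    rcases (hadj p x).1 hpxa with h | h
    · exact ⟨p, x, Or.inl ⟨rfl, rfl⟩, mem_eraseOut.2 ⟨h, fun h' => hxw.2 h'.2⟩⟩
    · exact ⟨x, p, Or.inr ⟨rfl, rfl⟩, mem_eraseOut.2 ⟨h, fun h' => hxw.1 h'.1⟩⟩
  let O₂ := eraseOut O₁ c u
  have hc₂ : #(O₂ c) + 1 = #(O₁ c) := card_eraseOut_self hu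
  -- Without the borrowed arc the out-degree of `c` is odd, so another out-neighbor exists. Dropping
  -- it too restores evenness, and its doubled edge takes the second copy of the borrowed edge.
  obtain ⟨u', hu'⟩ : (O₂ c).Nonempty := by
    rw [← card_pos]
    obtain ⟨k, hk⟩ := hev₁ c
    omega
  let O₃ := eraseOut O₂ c u'
  have hc₃ : #(O₃ c) + 1 = #(O₂ c) := card_eraseOut_self hu'
  have hev₃ : ∀ v, Even (#(O₃ v)) := fun v => by
    by_cases h : v = c
    · subst h
      obtain ⟨k, hk⟩ := hev₁ v
      exact ⟨k - 1, by omega⟩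
    · simp only [O₃, O₂, eraseOut_of_ne h]
      exact hev₁ v
  have hsub : ∀ a b, b ∈ O₃ a → b ∈ O a := fun a b h =>
    (mem_eraseOut.1 (mem_eraseOut.1 (mem_eraseOut.1 h).1).1).1
  have hu₁ : u' ∈ O₁ c := (mem_eraseOut.1 hu').1
  have huu' : u' ≠ u := fun h => (mem_eraseOut.1 hu').2 ⟨rfl, h⟩
  have hne : ∀ b, b ∈ O₁ c → c ≠ b := fun b h =>
    ((hadj c b).2 (Or.inl (mem_eraseOut.1 h).1)).ne
  have hsym : ∀ a b y z : V, edgeWeight a b y z = edgeWeight b a y z := fun a b y z => by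
    simp only [edgeWeight, add_comm]
  refine (((decomp_outDbl O₃ (fun a b h h' => hO a b (hsub a b h) (hsub b a h')) hev₃ φ
    fun a b h => hφO a b (hsub a b h)).add (decomp_path hqpne hpx hqx)).add
    (decomp_path (hne u' hu₁).symm (hne u hu) huu')).congr fun y z => ?_
  have h1 := outDbl_eraseOut hw y z
  have h2 := outDbl_eraseOut hu y z
  have h3 := outDbl_eraseOut hu' y z
  have h4 : edgeWeight q p y z = edgeWeight r w y z := by
    rcases hqp with ⟨rfl, rfl⟩ | ⟨rfl, rfl⟩
    · rfl
    · exact hsym _ _ _ _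
  have h5 : edgeWeight p x y z = edgeWeight c u y z := by
    rcases hcu with ⟨rfl, rfl⟩ | ⟨rfl, rfl⟩
    · rfl
    · exact hsym _ _ _ _
  rw [h4, h5, hsym u' c, ← hdbl]
  simp only [O₃, O₂, O₁] at h1 h2 h3 ⊢
  omega

/-! ### Absorbing the edges inside a vertex set -/

/-- A choice of one related vertex for each vertex with at least two of them, in which no vertex is
chosen by much more than half of its related vertices. -/
theorem exists_balanced_choice (H : V → V → Prop) :
    ∃ pick : V → V, (∀ b, 2 ≤ #{a | H a b} → H (pick b) b) ∧
      ∀ a, 2 * #{b | 2 ≤ #{a | H a b} ∧ pick b = a} ≤ #{b | H a b} + 1 := by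
  -- Half the degree, rounded up. Hall's condition for matching into `cap a` copies of each `a`
  -- follows by double counting: each `b` has at least two incidences, each `a` at most `2 * cap a`.
  let cap : V → ℕ := fun a => (#{b | H a b} + 1) / 2
  let T : Type _ := {b : V // 2 ≤ #{a | H a b}}
  let t : T → Finset (Σ _ : V, ℕ) := fun b =>
    (univ.filter fun a => H a b.1).sigma fun a => range (cap a)
  have hall : ∀ s : Finset T, #s ≤ #(s.biUnion t) := by
    intro s
    let N : Finset V := s.biUnion fun b => univ.filter fun a => H a b.1
    have hN : s.biUnion t = N.sigma fun a => range (cap a) := by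
      ext ⟨a, n⟩
      simp only [t, N, mem_biUnion, mem_sigma, mem_filter, mem_univ, true_and, mem_range]
      tauto
    rw [hN, card_sigma]
    simp only [card_range]
    have h1 : 2 * #s ≤ ∑ b ∈ s, #{a | H a b.1} := by
      rw [mul_comm, ← smul_eq_mul]
      exact card_nsmul_le_sum _ _ _ fun b _ => b.2
    have h2 : ∑ b ∈ s, #{a | H a b.1} = ∑ a ∈ N, #{b ∈ s | H a b.1} := by
      refine Eq.trans (sum_congr rfl fun b hb => ?_)
        (sum_card_bipartiteAbove_eq_sum_card_bipartiteBelow fun (a : V) (b : T) => H a b.1).symm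
      congr 1
      ext a
      simp only [mem_filter, mem_univ, true_and, bipartiteBelow, N, mem_biUnion]
      exact ⟨fun h => ⟨⟨b, hb, h⟩, h⟩, fun h => h.2⟩
    have h3 : ∀ a ∈ N, #{b ∈ s | H a b.1} ≤ 2 * cap a := fun a _ => by
      have : #{b ∈ s | H a b.1} ≤ #{b | H a b} :=
        card_le_card_of_injOn Subtype.val (fun b hb => by simpa using (mem_filter.1 hb).2)
          Subtype.val_injective.injOn
      simp only [cap]
      omega
    have h4 := sum_le_sum h3
    rw [← mul_sum] at h4
    omega
  obtain ⟨g, hg, hgt⟩ := (all_card_le_biUnion_card_iff_exists_injective t).1 hall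
  have hmem : ∀ b : T, H (g b).1 b.1 ∧ (g b).2 < cap (g b).1 := fun b => by
    simpa [t] using hgt b
  refine ⟨fun b => if h : 2 ≤ #{a | H a b} then (g ⟨b, h⟩).1 else b, fun b h => ?_, fun a => ?_⟩
  · simpa only [h, dif_pos] using (hmem ⟨b, h⟩).1
  · have : #{b | 2 ≤ #{a | H a b} ∧ (if h : 2 ≤ #{a | H a b} then (g ⟨b, h⟩).1 else b) = a} ≤
        #(range (cap a)) := by
      refine card_le_card_of_injOn (fun b => if h : 2 ≤ #{a | H a b} then (g ⟨b, h⟩).2 else 0)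
        (fun b hb => ?_) (fun b hb c hc hbc => ?_)
      · obtain ⟨h, h1⟩ := (mem_filter.1 hb).2
        simp only [h, dif_pos] at h1
        have := (hmem ⟨b, h⟩).2
        rw [h1] at this
        simpa [h] using this
      · obtain ⟨h, h1⟩ := (mem_filter.1 hb).2
        obtain ⟨h', h1'⟩ := (mem_filter.1 hc).2
        simp only [h, h', dif_pos] at h1 h1' hbc
        have := hg (Sigma.ext (h1.trans h1'.symm) (heq_of_eq hbc))
        exact congrArg Subtype.val this
    rw [card_range] at this
    simp only [cap] at this
    beta_reduce
    omega

/-- Greedy choice of even increments that separate neighbors. -/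
theorem exists_separating_increments (w : V → V → ℕ) (hs : ∀ u v, w u v = w v u)
    (h0 : ∀ v, w v v = 0) (base : V → ℕ) (P : V → Prop) (hP : ∀ p q, P p → P q → w p q = 0) :
    ∃ f : V → ℕ, (∀ a, f a ≤ #{u | w a u ≠ 0}) ∧ (∀ a, P a → f a = 0) ∧
      ∀ u v, w u v ≠ 0 → base u + 2 * f u ≠ base v + 2 * f v := by
  suffices h : ∀ s : Finset V, ∃ f : V → ℕ, (∀ a, f a ≤ #{u | w a u ≠ 0}) ∧
      (∀ a, P a → f a = 0) ∧ ∀ u v, P u ∨ u ∈ s → P v ∨ v ∈ s → w u v ≠ 0 →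
        base u + 2 * f u ≠ base v + 2 * f v by
    obtain ⟨f, h1, h2, h3⟩ := h univ
    exact ⟨f, h1, h2, fun u v => h3 u v (by simp) (by simp)⟩
  intro s
  induction s using Finset.induction_on with
  | empty =>
    -- The vertices of `P` are pairwise nonadjacent and can be fixed at increment 0 from the start.
    exact ⟨fun _ => 0, by simp, by simp,
      fun u v hu hv h => absurd (hP u v (by simpa using hu) (by simpa using hv)) h⟩
  | insert a s _ ih =>
    obtain ⟨f, h1, h2, h3⟩ := ih
    by_cases ha : P a
    · refine ⟨f, h1, h2, fun u v hu hv => h3 u v ?_ ?_⟩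
      · rcases hu with hu | hu
        · exact Or.inl hu
        · exact (mem_insert.1 hu).elim (fun h => Or.inl (h ▸ ha)) Or.inr
      · rcases hv with hv | hv
        · exact Or.inl hv
        · exact (mem_insert.1 hv).elim (fun h => Or.inl (h ▸ ha)) Or.inr
    let N : Finset V := univ.filter fun u => w a u ≠ 0
    -- Each neighbor blocks at most one increment; truncated subtraction and division can only
    -- forbid values needlessly.
    let forb : Finset ℕ := N.image fun u => (base u + 2 * f u - base a) / 2
    obtain ⟨t, ht, htf⟩ : ∃ t ∈ range (#N + 1), t ∉ forb := by
      by_contra! hn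
      have := card_le_card (show range (#N + 1) ⊆ forb from hn)
      have h4 : #forb ≤ #N := card_image_le
      rw [card_range] at this
      omega
    have htne : ∀ u, w a u ≠ 0 → base a + 2 * t ≠ base u + 2 * f u := fun u hu heq => by
      apply htf
      exact mem_image.2 ⟨u, by simp [N, hu], by omega⟩
    refine ⟨Function.update f a t, fun b => ?_, fun b hb => ?_, fun u v hu hv huv => ?_⟩
    · by_cases hb : b = a
      · subst hb
        simpa using Nat.lt_succ_iff.1 (mem_range.1 ht)
      · simpa [hb] using h1 b
    · have : b ≠ a := fun h => ha (h ▸ hb)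
      simpa [this] using h2 b hb
    · have huvne : u ≠ v := fun h => huv (by rw [h, h0])
      by_cases hua : u = a
      · subst hua
        simpa [huvne.symm] using htne v huv
      · by_cases hva : v = a
        · subst hva
          simpa [huvne] using (htne u (by rwa [hs])).symm
        · simpa [hua, hva] using h3 u v (by simpa [hua] using hu) (by simpa [hva] using hv) huv

theorem wdeg_outDbl (F : V → Finset V) (x : V) :
    wdeg (outDbl F) x = 2 * #(F x) + 2 * #{a | x ∈ F a} := by
  simp only [wdeg, outDbl, sum_add_distrib, ← sum_filter, sum_const, smul_eq_mul]
  simp [mul_comm]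

/-- A weighting inside `A` is made locally irregular by doubled edges leaving `A`, where the fixed
edges `j` make the degrees odd outside `A` and even in `A`. -/
theorem exists_locally_irregular_extension (A P : V → Prop) (w j : V → V → ℕ) (S : V → Finset V)
    (hs : ∀ u v, w u v = w v u) (h0 : ∀ v, w v v = 0) (hA : ∀ u v, w u v ≠ 0 → A u ∧ A v)
    (hP : ∀ p q, P p → P q → w p q = 0)
    (hj : ∀ a b, j a b ≠ 0 → A a ∧ ¬ A b ∧ ¬ P a) (hS : ∀ a b, b ∈ S a → A a ∧ ¬ A b ∧ ¬ P a)
    (hj1 : ∀ b, ∑ a, j a b ≤ 1)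
    (hpend : ∀ b, ∑ a, j a b = 0 → ∀ a a', b ∈ S a → b ∈ S a' → a = a')
    (heven : ∀ a, A a → ¬ P a → Even (wdeg w a + ∑ b, j a b))
    (hcap : ∀ a, A a → ¬ P a → #{u | w a u ≠ 0} ≤ #(S a)) :
    ∃ F : V → Finset V, (∀ a, F a ⊆ S a) ∧
      IsLI (fun u v => w u v + (j u v + j v u) + outDbl F u v) := by
  obtain ⟨f, f1, f2, f3⟩ := exists_separating_increments w hs h0
    (fun a => wdeg w a + ∑ b, j a b) P hP
  have hF : ∀ a, ∃ T ⊆ S a, #T = f a := fun a => by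
    apply exists_subset_card_eq
    by_cases ha : A a ∧ ¬ P a
    · exact (f1 a).trans (hcap a ha.1 ha.2)
    · suffices f a = 0 by omega
      by_cases hPa : P a
      · exact f2 a hPa
      · have hAa : ¬ A a := fun h => ha ⟨h, hPa⟩
        have h1 := f1 a
        rw [filter_false_of_mem (fun u _ => not_not.2 (by_contra fun h => hAa (hA a u h).1))] at h1
        simpa using h1
  choose F hFS hFc using hF
  refine ⟨F, hFS, ?_⟩
  set W : V → V → ℕ := fun u v => w u v + (j u v + j v u) + outDbl F u v with hW
  have hdeg : ∀ x, wdeg W x = wdeg w x + (∑ b, j x b + ∑ a, j a x) +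
      (2 * f x + 2 * #{a | x ∈ F a}) := fun x => by
    rw [← hFc, ← wdeg_outDbl]
    simp only [hW, wdeg, sum_add_distrib]
  have hFA : ∀ a b, b ∈ F a → A a ∧ ¬ A b ∧ ¬ P a := fun a b h => hS a b (hFS a h)
  have hin : ∀ x, A x → wdeg W x = wdeg w x + ∑ b, j x b + 2 * f x := fun x hx => by
    have h1 : ∑ a, j a x = 0 := sum_eq_zero fun a _ => by_contra fun h => (hj a x h).2.1 hx
    have h2 : (univ.filter fun a => x ∈ F a) = ∅ :=
      filter_false_of_mem fun a _ h => (hFA a x h).2.1 hx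
    rw [hdeg, h1, h2, card_empty]
    omega
  have hout : ∀ x, ¬ A x → wdeg W x = ∑ a, j a x + 2 * #{a | x ∈ F a} := fun x hx => by
    have h1 : ∑ b, j x b = 0 := sum_eq_zero fun b _ => by_contra fun h => hx (hj x b h).1
    have h2 : wdeg w x = 0 := sum_eq_zero fun b _ => by_contra fun h => hx (hA x b h).1
    have h3 : f x = 0 := by
      rw [← hFc, card_eq_zero, eq_empty_iff_forall_notMem]
      exact fun b hb => hx (hFA x b hb).1
    rw [hdeg, h1, h2, h3]
    omega
  -- If `v` receives a `j`-edge, its degree is odd and that of `u` is even. Otherwise `v` has degree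
  -- 2, while `u` has a positive increment and hence also positive `w`-degree, so degree above 2.
  have key : ∀ u v, A u → ¬ A v → 0 < W u v → wdeg W u ≠ wdeg W v := by
    intro u v hu hv h
    have hw0 : w u v = 0 := by_contra fun h => hv (hA u v h).2
    have hj0 : j v u = 0 := by_contra fun h => hv (hj v u h).1
    have hF0 : u ∉ F v := fun h => hv (hFA v u h).1
    have hor : j u v ≠ 0 ∨ v ∈ F u := by
      by_contra hn
      simp only [not_or, not_not] at hn
      simp [hW, hw0, hj0, hn, outDbl, hF0] at h
    have hPu : ¬ P u := hor.elim (fun h => (hj u v h).2.2) (fun h => (hFA u v h).2.2)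
    obtain ⟨k, hk⟩ := heven u hu hPu
    rw [hin u hu, hout v hv]
    by_cases h1 : ∑ a, j a v = 0
    · have hjuv : j u v = 0 := (sum_eq_zero_iff.1 h1) u (mem_univ u)
      have hvF : v ∈ F u := hor.resolve_left (not_not.2 hjuv)
      have hone : (univ.filter fun a => v ∈ F a) = {u} := by
        ext a
        simp only [mem_filter, mem_univ, true_and, mem_singleton]
        exact ⟨fun h => hpend v h1 a u (hFS a h) (hFS u hvF), fun h => h ▸ hvF⟩
      have hfu : 0 < f u := by
        rw [← hFc]
        exact card_pos.2 ⟨v, hvF⟩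
      obtain ⟨x, hx⟩ := card_pos.1 (hfu.trans_le (f1 u))
      have hx' : w u x ≠ 0 := (mem_filter.1 hx).2
      have hle : w u x ≤ wdeg w u :=
        single_le_sum (f := fun x => w u x) (fun _ _ => Nat.zero_le _) (mem_univ x)
      rw [h1, hone, card_singleton]
      omega
    · have := hj1 v
      omega
  intro u v h
  by_cases hu : A u
  · by_cases hv : A v
    · have hw : w u v ≠ 0 := by
        have h1 : j u v = 0 := by_contra fun h => (hj u v h).2.1 hv
        have h2 : j v u = 0 := by_contra fun h => (hj v u h).2.1 hu
        have h3 : v ∉ F u := fun h => (hFA u v h).2.1 hv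
        have h4 : u ∉ F v := fun h => (hFA v u h).2.1 hu
        intro h0
        simp [hW, h0, h1, h2, h3, h4, outDbl] at h
      rw [hin u hu, hin v hv]
      exact f3 u v hw
    · exact key u v hu hv h
  · by_cases hv : A v
    · refine (key v u hv hu ?_).symm
      have : W v u = W u v := by
        simp only [hW, hs v u, outDbl]
        omega
      rwa [this]
    · exfalso
      have h0 : w u v = 0 := by_contra fun h => hu (hA u v h).1
      have h1 : j u v = 0 := by_contra fun h => hu (hj u v h).1
      have h2 : j v u = 0 := by_contra fun h => hv (hj v u h).1
      have h3 : v ∉ F u := fun h => hu (hFA u v h).1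
      have h4 : u ∉ F v := fun h => hv (hFA v u h).1
      simp [hW, h0, h1, h2, h3, h4, outDbl] at h

/-! ### Reduction to a 9-colorable graph -/

theorem sum_sum_symm (c : V → V → ℕ) (hs : ∀ u v, c u v = c v u) (v : V) (h0 : c v v = 0) :
    ∑ x, ∑ y, c x y =
      2 * ∑ y, c v y + ∑ x ∈ univ.erase v, ∑ y ∈ univ.erase v, c x y := by
  have h1 : ∀ x, ∑ y, c x y = c x v + ∑ y ∈ univ.erase v, c x y := fun x =>
    (add_sum_erase _ _ (mem_univ v)).symm
  rw [← add_sum_erase _ _ (mem_univ v), sum_congr rfl fun x _ => h1 x, sum_add_distrib]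
  have h2 : ∑ x ∈ univ.erase v, c x v = ∑ y, c v y := by
    rw [h1 v, h0, zero_add]
    exact sum_congr rfl fun x _ => hs x v
  omega

/-- A partition into `n` parts in which no vertex has more neighbors in its own part than in any
other part. -/
theorem exists_max_cut (G : SimpleGraph V) (n : ℕ) [NeZero n] :
    ∃ part : V → Fin n, ∀ v k,
      #{u | G.Adj v u ∧ part u = part v} ≤ #{u | G.Adj v u ∧ part u = k} := by
  let c : (V → Fin n) → V → V → ℕ := fun p u v => if G.Adj u v ∧ p u = p v then 1 else 0
  -- Minimize the number of edges inside parts; moving a single vertex cannot improve the count.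
  obtain ⟨p, hp⟩ := Finite.exists_min fun p : V → Fin n => ∑ x, ∑ y, c p x y
  have hc : ∀ p u v, c p u v = c p v u := fun p u v => by
    simp only [c, G.adj_comm u v, eq_comm (a := p u)]
  have hc0 : ∀ p v, c p v v = 0 := fun p v => by simp [c]
  refine ⟨p, fun v k => ?_⟩
  have h1 := hp (Function.update p v k)
  rw [sum_sum_symm _ (hc _) v (hc0 _ v), sum_sum_symm _ (hc _) v (hc0 _ v)] at h1
  have h2 : ∑ x ∈ univ.erase v, ∑ y ∈ univ.erase v, c (Function.update p v k) x y =
      ∑ x ∈ univ.erase v, ∑ y ∈ univ.erase v, c p x y :=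
    sum_congr rfl fun x hx => sum_congr rfl fun y hy => by
      simp only [c, Function.update_of_ne (ne_of_mem_erase hx),
        Function.update_of_ne (ne_of_mem_erase hy)]
  have h3 : ∑ y, c p v y = #{u | G.Adj v u ∧ p u = p v} := by
    simp only [c, sum_boole, Nat.cast_id, eq_comm (a := p v)]
  have h4 : ∑ y, c (Function.update p v k) v y = #{u | G.Adj v u ∧ p u = k} := by
    simp only [c, sum_boole, Nat.cast_id, Function.update_self]
    congr 1
    refine filter_congr fun u _ => and_congr_right fun h => ?_
    rw [Function.update_of_ne h.ne', eq_comm]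
  omega

theorem outDbl_union {V : Type*} {F₁ F₂ : V → Finset V} (h : ∀ a, Disjoint (F₁ a) (F₂ a)) (x y : V) :
    outDbl F₁ x y + outDbl F₂ x y = outDbl (fun a => F₁ a ∪ F₂ a) x y := by
  have key : ∀ x y, (if y ∈ F₁ x then 2 else 0) + (if y ∈ F₂ x then 2 else 0) =
      if y ∈ F₁ x ∪ F₂ x then 2 else 0 := fun x y => by
    by_cases h1 : y ∈ F₁ x
    · simp [h1, disjoint_left.1 (h x) h1]
    · simp [h1]
  have h1 := key x y
  have h2 := key y x
  simp only [outDbl]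
  omega

/-- The edges inside a set `A`, together with some edges leaving it, form a graph whose double
splits into two locally irregular weightings, if every vertex of `A` has four times as many edges
leaving `A` as neighbors in `A`. -/
theorem exists_decomp_inside (G : SimpleGraph V) (A : V → Prop) (L : V → V → Prop)
    (hL : ∀ a b, L a b → A a ∧ ¬ A b ∧ G.Adj a b)
    (hd : ∀ a, A a → 4 * #{b | G.Adj a b ∧ A b} ≤ #{b | L a b}) :
    ∃ M : SimpleGraph V, (∀ u v, A u → A v → G.Adj u v → M.Adj u v) ∧
      (∀ u v, M.Adj u v → G.Adj u v ∧ (A u ∧ A v ∨ L u v ∨ L v u)) ∧ Decomp 2 (dbl M) := by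
  let K : SimpleGraph V :=
    { Adj := fun x y => G.Adj x y ∧ A x ∧ A y
      symm := ⟨fun x y h => ⟨h.1.symm, h.2.2, h.2.1⟩⟩
      loopless := ⟨fun x h => G.loopless.irrefl x h.1⟩ }
  have hK : ∀ u v, K.Adj u v ↔ G.Adj u v ∧ A u ∧ A v := fun _ _ => Iff.rfl
  let rep : V → V := fun v => (K.connectedComponentMk v).out
  have hrep : ∀ v, K.Reachable (rep v) v := fun v =>
    SimpleGraph.ConnectedComponent.exact (Quot.out_eq (K.connectedComponentMk v))
  have hrep' : ∀ u v, K.Reachable u v → rep u = rep v := fun u v h => by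
    simp only [rep, SimpleGraph.ConnectedComponent.sound h]
  obtain ⟨H, hH⟩ : ∃ H : V → V → Prop, ∀ a b, H a b ↔ L a b ∧ a ≠ rep a :=
    ⟨_, fun _ _ => Iff.rfl⟩
  obtain ⟨pick, hpick, hload⟩ := exists_balanced_choice H
  -- An outer vertex with at least two available edges has one of them split between the two
  -- weightings, making its degree odd in both.
  let j : V → V → ℕ := fun a b => if 2 ≤ #{a | H a b} ∧ pick b = a then 1 else 0
  have hjH : ∀ a b, j a b ≠ 0 → H a b := fun a b h => by
    have h' : 2 ≤ #{a | H a b} ∧ pick b = a := by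
      by_contra hn
      simp [j, hn] at h
    rw [← h'.2]
    exact hpick b h'.1
  have hjsum : ∀ b, ∑ a, j a b = if 2 ≤ #{a | H a b} then 1 else 0 := fun b => by
    by_cases hb : 2 ≤ #{a | H a b} <;> simp [j, hb]
  obtain ⟨J, Js, J1, Ja, Jp⟩ := exists_parity_subgraph K (fun v => ((∑ b, j v b : ℕ) : ZMod 2))
    rep (fun v _ => (hrep v).symm)
  have hJeven : ∀ a, a ≠ rep a → Even (wdeg J a + ∑ b, j a b) := fun a ha => by
    have h1 : (univ.filter fun v => rep v = a) = ∅ := filter_false_of_mem fun v _ h => ha (by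
      have h2 := hrep' (rep v) v (hrep v)
      rw [h] at h2
      exact h2.symm)
    have h2 := Jp a
    rw [h1, sum_empty, add_zero] at h2
    rw [← ZMod.natCast_eq_zero_iff_even, Nat.cast_add, h2]
    exact CharTwo.add_self_eq_zero _
  -- The inner edges split as `w + J`. Both have the degree parities of `j` away from
  -- representatives, so both can be extended using `j`.
  let w : V → V → ℕ := fun u v => dbl K u v - J u v
  have hJle : ∀ u v, J u v ≤ dbl K u v := fun u v => by
    by_cases h : J u v = 0
    · rw [h]
      exact Nat.zero_le _
    · have := J1 u v
      simp only [dbl, Ja u v h, if_true]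
      omega
  have hwJ : ∀ u v, w u v + J u v = dbl K u v := fun u v => Nat.sub_add_cancel (hJle u v)
  have hwK : ∀ u v, w u v ≠ 0 → K.Adj u v := fun u v h => by
    by_contra hn
    simp [w, dbl, hn] at h
  have hweven : ∀ a, a ≠ rep a → Even (wdeg w a + ∑ b, j a b) := fun a ha => by
    have h1 : wdeg w a + wdeg J a = wdeg (dbl K) a := by
      simp only [wdeg, ← sum_add_distrib, hwJ]
    have h2 : Even (wdeg (dbl K) a) :=
      even_sum _ fun u _ => by simp only [dbl]; split_ifs <;> simp
    obtain ⟨p, hp⟩ := h2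
    obtain ⟨q, hq⟩ := hJeven a ha
    exact ⟨p + (∑ b, j a b) - q, by omega⟩
  let S : V → Finset V := fun a => univ.filter fun b => H a b ∧ j a b = 0
  -- With `d` inner neighbors and `h ≥ 4 * d` available edges, at most `(h + 1) / 2` are split,
  -- leaving at least `2 * d`: `d` for each weighting.
  have hScard : ∀ a, A a → a ≠ rep a → 2 * #{b | K.Adj a b} ≤ #(S a) := by
    intro a ha har
    have h1 : #{b | K.Adj a b} = #{b | G.Adj a b ∧ A b} := by simp [hK, ha]
    have h2 : #{b | H a b} = #{b | L a b} := by simp [hH, har]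
    have h3 := hd a ha
    have h4 := hload a
    have h5 : #{b | H a b} ≤ #(S a) + #{b | 2 ≤ #{a | H a b} ∧ pick b = a} := by
      refine (card_le_card fun b hb => ?_).trans (card_union_le _ _)
      have hb' : H a b := (mem_filter.1 hb).2
      by_cases h : 2 ≤ #{a | H a b} ∧ pick b = a
      · exact mem_union_right _ (by simpa using h)
      · refine mem_union_left _ (mem_filter.2 ⟨mem_univ b, hb', ?_⟩)
        simp only [j]
        rw [if_neg h]
    omega
  have hS₁ : ∀ a, ∃ T ⊆ S a, A a → a ≠ rep a → #T = #{b | K.Adj a b} := fun a => by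
    by_cases h : A a ∧ a ≠ rep a
    · obtain ⟨T, h1, h2⟩ := exists_subset_card_eq
        (show #{b | K.Adj a b} ≤ #(S a) by have := hScard a h.1 h.2; omega)
      exact ⟨T, h1, fun _ _ => h2⟩
    · exact ⟨∅, empty_subset _, fun h1 h2 => absurd ⟨h1, h2⟩ h⟩
  choose S₁ hS₁S hS₁c using hS₁
  let S₂ : V → Finset V := fun a => S a \ S₁ a
  have hS₂c : ∀ a, A a → a ≠ rep a → #{b | K.Adj a b} ≤ #(S₂ a) := fun a h1 h2 => by
    have h3 := hScard a h1 h2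
    have h4 := hS₁c a h1 h2
    have h5 := card_sdiff_add_card_eq_card (hS₁S a)
    simp only [S₂]
    omega
  have hHA : ∀ a b, H a b → A a ∧ ¬ A b ∧ ¬ a = rep a := fun a b h =>
    ⟨(hL a b ((hH a b).1 h).1).1, (hL a b ((hH a b).1 h).1).2.1, ((hH a b).1 h).2⟩
  have hPK : ∀ p q, p = rep p → q = rep q → ¬ K.Adj p q := fun p q hp hq h =>
    h.ne (by rw [hp, hq, hrep' p q h.reachable])
  have hSH : ∀ a b, b ∈ S a → H a b := fun a b h => (mem_filter.1 h).2.1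
  have hj1 : ∀ b, ∑ a, j a b ≤ 1 := fun b => by
    rw [hjsum]
    split_ifs <;> simp
  have hpend : ∀ b, ∑ a, j a b = 0 → ∀ a a', H a b → H a' b → a = a' := by
    intro b hb a a' ha ha'
    have h1 : ¬ 2 ≤ #{a | H a b} := fun h => by simp [hjsum, h] at hb
    exact card_le_one.1 (by omega : #{a | H a b} ≤ 1) a (by simpa using ha) a' (by simpa using ha')
  have hext : ∀ (x : V → V → ℕ) (T : V → Finset V), (∀ u v, x u v = x v u) →
      (∀ u v, x u v ≠ 0 → K.Adj u v) → (∀ a, T a ⊆ S a) →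
      (∀ a, a ≠ rep a → Even (wdeg x a + ∑ b, j a b)) →
      (∀ a, A a → a ≠ rep a → #{b | K.Adj a b} ≤ #(T a)) →
      ∃ F : V → Finset V, (∀ a, F a ⊆ T a) ∧
        Decomp 1 (fun u v => x u v + (j u v + j v u) + outDbl F u v) := by
    intro x T xs xK hT hxe hTc
    obtain ⟨F, hF, hLI⟩ := exists_locally_irregular_extension A (fun a => a = rep a) x j T xs
      (fun v => by_contra fun h => (xK v v h).ne rfl)
      (fun u v h => (xK u v h).2)
      (fun p q hp hq => by_contra fun h => hPK p q hp hq (xK p q h))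
      (fun a b h => hHA a b (hjH a b h)) (fun a b h => hHA a b (hSH a b (hT a h))) hj1
      (fun b hb a a' h h' => hpend b hb a a' (hSH a b (hT a h)) (hSH a' b (hT a' h')))
      (fun a _ h => hxe a h)
      (fun a ha h => (card_le_card fun u hu => by
        simpa using xK a u (mem_filter.1 hu).2).trans (hTc a ha h))
    refine ⟨F, hF, Decomp.single (fun u v => ?_) hLI⟩
    rw [xs u v]
    simp only [outDbl]
    omega
  obtain ⟨F₁, hF₁, hD₁⟩ := hext w S₁ (fun u v => by simp only [w, dbl_comm K u v, Js u v]) hwK hS₁S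
    hweven (fun a h1 h2 => (hS₁c a h1 h2).ge)
  obtain ⟨F₂, hF₂, hD₂⟩ := hext J S₂ Js Ja (fun a => sdiff_subset) hJeven hS₂c
  let N : V → Finset V := fun a => (F₁ a ∪ F₂ a) ∪ univ.filter fun b => j a b ≠ 0
  have hdisj : ∀ a, Disjoint (F₁ a) (F₂ a) := fun a =>
    disjoint_of_subset_left (hF₁ a) (disjoint_of_subset_right (hF₂ a) disjoint_sdiff)
  have hFS : ∀ a b, b ∈ F₁ a ∪ F₂ a → b ∈ S a := fun a b h =>
    (mem_union.1 h).elim (fun h => hS₁S a (hF₁ a h)) (fun h => sdiff_subset (hF₂ a h))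
  have hNH : ∀ a b, b ∈ N a → H a b := fun a b h =>
    (mem_union.1 h).elim (fun h => hSH a b (hFS a b h)) (fun h => hjH a b (mem_filter.1 h).2)
  have hNN : ∀ a b, b ∈ N a → a ∉ N b := fun a b h h' =>
    (hHA a b (hNH a b h)).2.1 (hHA b a (hNH b a h')).1
  let M : SimpleGraph V :=
    { Adj := fun u v => K.Adj u v ∨ v ∈ N u ∨ u ∈ N v
      symm := ⟨fun u v h => h.elim (fun h => Or.inl h.symm) (fun h => Or.inr h.symm)⟩
      loopless := ⟨fun u h => h.elim (fun h => h.ne rfl) (fun h =>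
        hNN u u (h.elim id id) (h.elim id id))⟩ }
  have hM : ∀ u v, M.Adj u v ↔ K.Adj u v ∨ v ∈ N u ∨ u ∈ N v := fun _ _ => Iff.rfl
  refine ⟨M, fun u v hu hv h => Or.inl ⟨h, hu, hv⟩, fun u v h => ?_,
    (hD₁.add hD₂).congr fun u v => ?_⟩
  · rcases h with h | h | h
    · exact ⟨h.1, Or.inl h.2⟩
    · have := ((hH u v).1 (hNH u v h)).1
      exact ⟨(hL u v this).2.2, Or.inr (Or.inl this)⟩
    · have := ((hH v u).1 (hNH v u h)).1
      exact ⟨(hL v u this).2.2.symm, Or.inr (Or.inr this)⟩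
  · have hN : ∀ u v, 2 * j u v + (if v ∈ F₁ u ∪ F₂ u then 2 else 0) =
        if v ∈ N u then 2 else 0 := fun u v => by
      have h01 : j u v = 0 ∨ j u v = 1 := by
        simp only [j]
        split_ifs <;> simp
      rcases h01 with h | h
      · simp [N, h]
      · have : v ∉ F₁ u ∪ F₂ u := fun h' => by
          have := (mem_filter.1 (hFS u v h')).2.2
          omega
        rw [if_neg this]
        simp [N, h]
    have h1 := hwJ u v
    have h2 := outDbl_union hdisj u v
    have h3 := hN u v
    have h4 := hN v u
    have h5 : dbl M u v = dbl K u v + ((if v ∈ N u then 2 else 0) + if u ∈ N v then 2 else 0) := by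
      simp only [dbl, hM]
      by_cases hk : K.Adj u v
      · have h6 : v ∉ N u := fun h => (hHA u v (hNH u v h)).2.1 hk.2.2
        have h7 : u ∉ N v := fun h => (hHA v u (hNH v u h)).2.1 hk.2.1
        simp [hk, h6, h7]
      · by_cases h6 : v ∈ N u
        · simp [hk, h6, hNN u v h6]
        · simp [hk, h6]
    rw [h5]
    simp only [outDbl] at h2 ⊢
    omega

/-- Every graph is the union of a `9`-colorable graph and a graph whose double splits into
eighteen locally irregular weightings. -/
theorem exists_decomp_add_colorable (G : SimpleGraph V) :
    ∃ (R : SimpleGraph V) (part : V → Fin 9) (m : V → V → ℕ), R ≤ G ∧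
      (∀ u v, R.Adj u v → part u ≠ part v) ∧ Decomp 18 m ∧
      ∀ u v, m u v + dbl R u v = dbl G u v := by
  obtain ⟨part, hpart⟩ := exists_max_cut G 9
  -- For nonzero `d` modulo 9, exactly one of `d` and `-d` is in `D`, so each pair of parts serves
  -- only one of the two and the graphs `M i` are edge-disjoint.
  let D : Finset (Fin 9) := {1, 2, 3, 4}
  have hD0 : ∀ i k : Fin 9, k - i ∈ D → k ≠ i := by decide
  have hD1 : ∀ i k : Fin 9, k - i ∈ D → i - k ∉ D := by decide
  obtain ⟨L, hL⟩ : ∃ L : Fin 9 → V → V → Prop,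
      ∀ i a b, L i a b ↔ part a = i ∧ part b - part a ∈ D ∧ G.Adj a b :=
    ⟨_, fun _ _ _ => Iff.rfl⟩
  have h := fun i => exists_decomp_inside G (fun v => part v = i) (L i)
    (fun a b h => by
      obtain ⟨rfl, h2, h3⟩ := (hL i a b).1 h
      exact ⟨rfl, hD0 _ _ h2, h3⟩) (fun a ha => by
      have h1 : #{b | L i a b} =
          ∑ k ∈ D, #{b | G.Adj a b ∧ part b = k + i} := by
        rw [card_eq_sum_card_fiberwise (f := fun b => part b - i) (t := D)]
        · refine sum_congr rfl fun k hk => ?_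
          congr 1
          ext b
          simp only [mem_filter, mem_univ, true_and, hL, ha, sub_eq_iff_eq_add]
          constructor
          · rintro ⟨⟨_, h2⟩, h3⟩
            exact ⟨h2, h3⟩
          · rintro ⟨h2, h3⟩
            exact ⟨⟨by simpa [h3] using hk, h2⟩, h3⟩
        · intro b hb
          have := (hL i a b).1 (mem_filter.1 hb).2
          rw [← ha]
          exact this.2.1
      rw [h1]
      have h2 : #D • #{b | G.Adj a b ∧ part b = i} ≤
          ∑ k ∈ D, #{b | G.Adj a b ∧ part b = k + i} :=
        card_nsmul_le_sum _ _ _ fun k _ => by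
          rw [← ha]
          exact hpart a _
      rw [show #D = 4 from rfl, smul_eq_mul] at h2
      convert h2)
  choose M hM1 hM2 hM3 using h
  let R : SimpleGraph V :=
    { Adj := fun u v => G.Adj u v ∧ ∀ i, ¬ (M i).Adj u v
      symm := ⟨fun u v h => ⟨h.1.symm, fun i h' => h.2 i h'.symm⟩⟩
      loopless := ⟨fun u h => G.loopless.irrefl u h.1⟩ }
  simp only [hL] at hM2
  have huniq : ∀ i k u v, (M i).Adj u v → (M k).Adj u v → i = k := by
    intro i k u v hi hk
    rcases (hM2 i u v hi).2 with ⟨h1, h2⟩ | ⟨h1, h2, -⟩ | ⟨h1, h2, -⟩ <;>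
      rcases (hM2 k u v hk).2 with ⟨h3, h4⟩ | ⟨h3, h4, -⟩ | ⟨h3, h4, -⟩
    · rw [← h1, h3]
    · rw [← h1, h3]
    · rw [← h2, h3]
    · rw [← h1, h3]
    · rw [← h1, h3]
    · exact absurd h4 (hD1 _ _ h2)
    · rw [← h1, h4]
    · exact absurd h4 (hD1 _ _ h2)
    · rw [← h1, h3]
  refine ⟨R, part, fun u v => ∑ i, dbl (M i) u v, fun u v h => h.1, fun u v h heq => ?_,
    Decomp.sum (n := 9) (k := 2) hM3, fun u v => ?_⟩
  · exact h.2 (part u) (hM1 (part u) u v rfl heq.symm h.1)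
  · beta_reduce
    by_cases hg : G.Adj u v
    · by_cases hm : ∃ i, (M i).Adj u v
      · obtain ⟨i, hi⟩ := hm
        have h1 : ∑ k, dbl (M k) u v = dbl (M i) u v := by
          refine sum_eq_single i (fun k _ hk => ?_) (by simp)
          simp only [dbl, ite_eq_right_iff]
          exact fun h => absurd (huniq k i u v h hi) hk
        rw [h1]
        have h2 : ¬ R.Adj u v := fun h => h.2 i hi
        simp [dbl, hi, h2, hg]
      · have h2 : R.Adj u v := ⟨hg, fun i hi => hm ⟨i, hi⟩⟩
        have h1 : ∑ k, dbl (M k) u v = 0 :=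
          sum_eq_zero fun k _ => by simp [dbl, h2.2 k]
        rw [h1, zero_add]
        simp [dbl, h2, hg]
    · have h2 : ¬ R.Adj u v := fun h => hg h.1
      have h1 : ∑ k, dbl (M k) u v = 0 := sum_eq_zero fun k _ => by
        have : ¬ (M k).Adj u v := fun h => hg (hM2 k u v h).1
        simp [dbl, this]
      rw [h1]
      simp [dbl, h2, hg]

/-! ### Connected graphs and the theorem -/

/-- A spanning tree keeps the part of the graph that is left over connected. -/
theorem decomp_of_connected (G : SimpleGraph V) (hG : G.Connected)
    (hK : ∀ u v, G.Adj u v → ∃ x, x ≠ u ∧ x ≠ v) : Decomp 65 (dbl G) := by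
  obtain ⟨T, hTG, hT⟩ := hG.exists_isTree_le
  obtain ⟨R, part, m, hRG, hR, hm, hmR⟩ := exists_decomp_add_colorable (G \ T)
  let col := hT.coloringTwo
  let Q : SimpleGraph V := R ⊔ T
  have hQ : Q.Connected := hT.connected.mono le_sup_right
  have hQG : Q ≤ G := sup_le (hRG.trans sdiff_le) hTG
  -- Four bits encode the nine parts and separate the ends of edges of `R`; the fifth is a
  -- 2-coloring of the tree.
  let φ : V → Fin 5 → Bool :=
    fun v i => if i = 4 then decide (col v = 0) else (part v).val.testBit i.val
  have hbits : ∀ a b : Fin 9, (∀ i : Fin 5, i ≠ 4 → a.val.testBit i.val = b.val.testBit i.val) →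
      a = b := by decide
  have hφ : ∀ u v, Q.Adj u v → φ u ≠ φ v := by
    rintro u v (h | h) heq
    · refine hR u v h (hbits _ _ fun i hi => ?_)
      simpa [φ, hi] using congrFun heq i
    · have h1 := col.valid h
      have h2 : decide (col u = 0) = decide (col v = 0) := by simpa [φ] using congrFun heq 4
      rw [decide_eq_decide] at h2
      omega
  have hQK : ∀ u v, Q.Adj u v → (∃ x, x ≠ v ∧ Q.Adj u x) ∨ ∃ x, x ≠ u ∧ Q.Adj v x := by
    intro u v huv
    by_contra! hn
    obtain ⟨x, hxu, hxv⟩ := hK u v (hQG huv)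
    -- An isolated edge of the connected graph `Q` would be all of `Q`, contradicting the third
    -- vertex `x`.
    have hclosed : ∀ a b, Q.Reachable a b → a = u ∨ a = v → b = u ∨ b = v := by
      rintro a b ⟨p⟩
      induction p with
      | nil => exact id
      | cons h p ih =>
        rintro (rfl | rfl)
        · exact ih (Or.inr (by_contra fun h' => hn.1 _ h' h))
        · exact ih (Or.inl (by_contra fun h' => hn.2 _ h' h))
    exact (hclosed u x (hQ.preconnected u x) (Or.inl rfl)).elim hxu hxv
  refine (hm.add (decomp_of_coloring Q hQ.preconnected φ hφ hQK)).congr fun u v => ?_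
  have h1 := hmR u v
  have h2 : dbl Q u v = dbl R u v + dbl T u v := by
    by_cases hr : R.Adj u v
    · have ht : ¬ T.Adj u v := (hRG hr).2
      simp [dbl, Q, hr, ht]
    · simp [dbl, Q, hr]
  have h3 : dbl G u v = dbl (G \ T) u v + dbl T u v := by
    by_cases ht : T.Adj u v
    · simp [dbl, ht, hTG ht]
    · simp [dbl, ht]
  omega

end LocallyIrregular

/-- Excluding `K₂` provides a vertex off every edge. As `lir` is `⊤` when no coloring exists, the
bound includes existence; the 65 weightings constructed leave slack. -/
theorem mainTheorem2 {V : Type*} [Fintype V] (G : SimpleGraph V) (hG : G.Connected)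
    (hK2 : IsEmpty (G ≃g (⊤ : SimpleGraph (Fin 2)))) :
    G.doubled.lir ≤ 76 := by
  have hK : ∀ u v, G.Adj u v → ∃ x, x ≠ u ∧ x ≠ v := by
    intro u v huv
    by_contra! hn
    have hall : ∀ x, x = u ∨ x = v := fun x => or_iff_not_imp_left.2 (hn x)
    let f : Fin 2 → V := ![u, v]
    have hf : Function.Bijective f := by
      constructor
      · intro i k h
        have h1 := huv.ne
        fin_cases i <;> fin_cases k <;> simp_all [f]
      · intro x
        rcases hall x with rfl | rfl
        · exact ⟨0, rfl⟩
        · exact ⟨1, rfl⟩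
    let e : Fin 2 ≃ V := Equiv.ofBijective f hf
    refine hK2.false (SimpleGraph.Iso.symm ⟨e, fun {i k} => ?_⟩)
    rw [SimpleGraph.top_adj]
    constructor
    · rintro h rfl
      exact h.ne rfl
    · intro h
      fin_cases i <;> fin_cases k
      · exact absurd rfl h
      · exact huv
      · exact huv.symm
      · exact absurd rfl h
  have h : G.doubled.LocallyIrregularColorable 76 :=
    ((LocallyIrregular.decomp_of_connected G hG hK).mono (by norm_num)).colorable
  exact iInf₂_le (76 : ℕ) h
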